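/- Let $G=\langle a_1,\dots,a_k\mid R_1,\dots,R_\ell\rangle$ be a finitely presented group, $k\ge 1$, whose relators $R_i$ are freely reduced and non-empty. Let $\mathcal S=\{a_1^{\pm1},\dots,a_k^{\pm1}\}$ ($2k$ formal letters), let $\mathcal X$ be the set of freely reduced words over $\mathcal S$ that represent the identity of $G$, and let $\mathcal R$ be the set of free reductions of all cyclic permutations of the words $R_i$ and $R_i^{-1}$. Write $|w|$ for the length of a word $w$. Let $p_c\in(0,1)$, $\alpha\in\mathbb R$, $\beta\in(0,1)$, and let $P$ be a probability distribution on $\mathcal R$ with $P(R)>0$ and $P(R)=P(R^{-1})$ for all $R\in\mathcal R$. Elementary moves on $w\in\mathcal X$: - Conjugation by $x\in\mathcal S$: the result $w''$ is the free reduction of $xwx^{-1}$. - Left-insertion of $R\in\mathcal R$ at position $m\in\{0,\dots,|w|\}$: write $w=uv$ with $|v|=m$ and let $u'$ be the free reduction of $uR$. If $u'v$ is freely reduced then $w''=u'v$; otherwise (a letter of $v$ would be cancelled) $w''=w$. Consider the Markov chain on $\mathcal X$ that moves from $w$ as follows. With probability $p_c$, choose $x\in\mathcal S$ uniformly, let $w''$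 be the result of conjugation by $x$, and move to $w''$ with probability $$\min\Bigl\{1,\ \frac{(|w''|+1)^{1+\alpha}}{(|w|+1)^{1+\alpha}}\cdot\frac{\beta^{|w''|}}{\beta^{|w|}}\Bigr\},$$ staying at $w$ otherwise. With probability $1-p_c$, choose $R\in\mathcal R$ with law $P$ and $m\in\{0,\dots,|w|\}$ uniformly, let $w''$ be the result of left-insertion of $R$ at $m$, and move to $w''$ with probability $$\min\Bigl\{1,\ \frac{(|w''|+1)^{\alpha}}{(|w|+1)^{\alpha}}\cdot\frac{\beta^{|w''|}}{\beta^{|w|}}\Bigr\},$$ staying at $w$ otherwise. Let $\Pr(u\to v)$ and $\Pr_n(u\to v)$ be its one-step and $n$-step transition probabilities. A probability distribution $\varphi$ on $\mathcal X$ is stationary if $\varphi(u)=\sum_{v}\Pr(v\to u)\varphi(v)$ for all $u\in\mathcal X$. Put $$Z=\sum_{w\in\mathcal X}(|w|+1)^{1+\alpha}\beta^{|w|}.$$ 1. If $\beta$ is less than the radius of convergence of the cogrowth series $\sum_n c(n)z^n$, where $c(n)$ is the number of words of length $n$ in $\mathcal X$, then $Z<\infty$. 2. Whenever $Z<\infty$,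 the formula $$\pi(v)=\frac{(|v|+1)^{1+\alpha}\beta^{|v|}}{Z}$$ defines a probability distribution on $\mathcal X$, it is the unique stationary distribution of the chain, and for all $u,v\in\mathcal X$ $$\Pr\nolimits_n(u\to v)\to\pi(v)\quad\text{as } n\to\infty.$$ -/

import Mathlib

open Filter Topology
open scoped ENNReal

namespace TrivialWords

/-- Words over the `2k` letters `a, a⁻¹` (`a` a generator): the letter `(a, true)` is `a` and
`(a, false)` is its formal inverse. -/
abbrev Word (A : Type*) := List (A × Bool)

/-- The formal inverse of a letter. -/
def letterInv {A : Type*} (x : A × Bool) : A × Bool := (x.1, !x.2)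

variable {A : Type*} [DecidableEq A]

/-- The state space: freely reduced words which represent the identity in `⟨A ∣ rels⟩`. -/
def State (rels : Set (FreeGroup A)) : Type _ :=
  {w : Word A // FreeGroup.IsReduced w ∧ PresentedGroup.mk rels (FreeGroup.mk w) = 1}

/-- The length of the word underlying a state. -/
def State.length {rels : Set (FreeGroup A)} (w : State rels) : ℕ := w.1.length

/-- The set `𝓡`: the free reductions of all cyclic permutations of the relators and of
their inverses. -/
def relatorSet (rels : Set (FreeGroup A)) : Set (Word A) :=
  {r | ∃ R ∈ rels, ∃ c : Word A,
    (c.IsRotated R.toWord ∨ c.IsRotated (FreeGroup.invRev R.toWord)) ∧ r = FreeGroup.reduce c}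

theorem isReduced_reduce (w : Word A) : FreeGroup.IsReduced (FreeGroup.reduce w) :=
  FreeGroup.IsReduced.of_reduce_eq FreeGroup.reduce.idem

theorem mk_reduce (w : Word A) : FreeGroup.mk (FreeGroup.reduce w) = FreeGroup.mk w :=
  FreeGroup.reduce.self

theorem mk_isRotated_trivial {rels : Set (FreeGroup A)} {c d : Word A} (h : c.IsRotated d)
    (hd : PresentedGroup.mk rels (FreeGroup.mk d) = 1) :
    PresentedGroup.mk rels (FreeGroup.mk c) = 1 := by
  obtain ⟨n, hn, rfl⟩ := List.isRotated_iff_mod.1 h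
  rw [List.rotate_eq_drop_append_take hn, ← FreeGroup.mul_mk, map_mul] at hd
  rw [← List.take_append_drop n c, ← FreeGroup.mul_mk, map_mul]
  exact mul_eq_one_comm.1 hd

theorem relatorSet_trivial {rels : Set (FreeGroup A)} {r : Word A} (hr : r ∈ relatorSet rels) :
    PresentedGroup.mk rels (FreeGroup.mk r) = 1 := by
  obtain ⟨R, hR, c, hc, rfl⟩ := hr
  rw [mk_reduce]
  rcases hc with hc | hc
  · refine mk_isRotated_trivial hc ?_
    rw [FreeGroup.mk_toWord]
    exact PresentedGroup.one_of_mem hR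
  · refine mk_isRotated_trivial hc ?_
    rw [← FreeGroup.inv_mk, FreeGroup.mk_toWord, map_inv, PresentedGroup.one_of_mem hR, inv_one]

theorem invRev_mem_relatorSet {rels : Set (FreeGroup A)} {r : Word A}
    (hr : r ∈ relatorSet rels) : FreeGroup.invRev r ∈ relatorSet rels := by
  obtain ⟨R, hR, c, hc, rfl⟩ := hr
  refine ⟨R, hR, FreeGroup.invRev c, ?_, (FreeGroup.reduce_invRev).symm⟩
  have key : ∀ {s t : Word A}, s.IsRotated t →
      (FreeGroup.invRev s).IsRotated (FreeGroup.invRev t) := by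
    intro s t h
    exact (h.map _).reverse
  rcases hc with hc | hc
  · exact Or.inr (key hc)
  · left
    simpa only [FreeGroup.invRev_invRev] using key hc

/-- The inverse `R⁻¹` of an element `R` of `𝓡`. -/
def relatorInv {rels : Set (FreeGroup A)} (R : relatorSet rels) : relatorSet rels :=
  ⟨FreeGroup.invRev R.1, invRev_mem_relatorSet R.2⟩

/-- Conjugation by the letter `x`: the free reduction of `x w x⁻¹`. -/
def conjMove {rels : Set (FreeGroup A)} (w : State rels) (x : A × Bool) : State rels :=
  ⟨FreeGroup.reduce (x :: w.1 ++ [letterInv x]), isReduced_reduce _, by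
    have h : FreeGroup.mk (x :: w.1 ++ [letterInv x])
        = FreeGroup.mk [x] * FreeGroup.mk w.1 * (FreeGroup.mk [x])⁻¹ := by
      simp [letterInv, FreeGroup.invRev]
    rw [mk_reduce, h, map_mul, map_mul, w.2.2, mul_one, map_inv, mul_inv_cancel]⟩

/-- Left-insertion of `R` at position `m`. Write `w = u v` with `|v| = m` and let `u'` be the free
reduction of `u R`. If `u' v` is freely reduced, the result is `u' v`; otherwise a letter of `v`
would be cancelled and the result is `w`. -/
def leftInsert {rels : Set (FreeGroup A)} (w : State rels) (R : relatorSet rels)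
    (m : Fin (w.length + 1)) : State rels :=
  let u := w.1.take (w.length - m)
  let v := w.1.drop (w.length - m)
  let u' := FreeGroup.reduce (u ++ R.1)
  if h : FreeGroup.reduce (u' ++ v) = u' ++ v then
    ⟨u' ++ v, FreeGroup.IsReduced.of_reduce_eq h, by
      have hw : PresentedGroup.mk rels (FreeGroup.mk (u ++ v)) = 1 := by
        rw [List.take_append_drop]; exact w.2.2
      rw [← FreeGroup.mul_mk, map_mul] at hw
      rw [← FreeGroup.mul_mk, map_mul, mk_reduce, ← FreeGroup.mul_mk, map_mul,
        relatorSet_trivial R.2, mul_one, hw]⟩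
  else w

/-- The Metropolis acceptance probability
`min {1, ((|w''| + 1)^e / (|w| + 1)^e) * (β^|w''| / β^|w|)}` for replacing `w` by `w''`. -/
noncomputable def acceptProb {rels : Set (FreeGroup A)} (e β : ℝ) (w w'' : State rels) : ℝ :=
  min 1 (((w''.length + 1 : ℝ) ^ e / (w.length + 1 : ℝ) ^ e) *
    (β ^ w''.length / β ^ w.length))

theorem acceptProb_mem {rels : Set (FreeGroup A)} (e : ℝ) {β : ℝ} (hβ : β ∈ Set.Ioo (0 : ℝ) 1)
    (w w'' : State rels) : acceptProb e β w w'' ∈ Set.Icc (0 : ℝ) 1 := by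
  have := hβ.1
  exact ⟨le_min zero_le_one (by positivity), min_le_left _ _⟩

/-- With probability `p` sample from `μ`, otherwise (with probability `1 - p`) from `ν`. -/
noncomputable def mix {X : Type*} (p : ℝ) (hp : p ∈ Set.Icc (0 : ℝ) 1) (μ ν : PMF X) : PMF X :=
  ⟨fun x => ENNReal.ofReal p * μ x + ENNReal.ofReal (1 - p) * ν x, by
    refine ENNReal.summable.hasSum_iff.2 ?_
    rw [ENNReal.tsum_add, ENNReal.tsum_mul_left, ENNReal.tsum_mul_left, μ.tsum_coe, ν.tsum_coe,
      mul_one, mul_one, ← ENNReal.ofReal_add hp.1 (by linarith [hp.2])]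
    simp⟩

/-- The proposal `w''` is accepted with probability `acceptProb e β w w''`; otherwise the chain
stays at `w`. -/
noncomputable def acceptReject {rels : Set (FreeGroup A)} (e β : ℝ) (hβ : β ∈ Set.Ioo (0 : ℝ) 1)
    (w w'' : State rels) : PMF (State rels) :=
  mix (acceptProb e β w w'') (acceptProb_mem e hβ w w'') (PMF.pure w'') (PMF.pure w)

/-- One step of the chain from the state `w`. With probability `pc` a letter is chosen uniformly
and conjugation by it is proposed (exponent `1 + α`); otherwise `R ∈ 𝓡` is chosen with law `P`, a
position in `{0, …, |w|}` is chosen uniformly, and the left-insertion is proposed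
(exponent `α`). -/
noncomputable def step {rels : Set (FreeGroup A)} [Fintype A] [Nonempty A]
    (pc : ℝ) (hpc : pc ∈ Set.Ioo (0 : ℝ) 1) (α β : ℝ) (hβ : β ∈ Set.Ioo (0 : ℝ) 1)
    (P : PMF (relatorSet rels)) (w : State rels) : PMF (State rels) :=
  mix pc (Set.Ioo_subset_Icc_self hpc)
    ((PMF.uniformOfFintype (A × Bool)).bind fun x =>
      acceptReject (1 + α) β hβ w (conjMove w x))
    (P.bind fun R => (PMF.uniformOfFintype (Fin (w.length + 1))).bind fun m =>
      acceptReject α β hβ w (leftInsert w R m))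

/-- The law of a Markov chain with one-step law `T` started at `u` after `n` steps. -/
noncomputable def nStep {X : Type*} (T : X → PMF X) : ℕ → X → PMF X
  | 0, u => PMF.pure u
  | n + 1, u => (nStep T n u).bind T

/-- A probability distribution `φ` is stationary if `φ(u) = ∑_v Pr(v → u) φ(v)` for all `u`. -/
def IsStationary {X : Type*} (T : X → PMF X) (φ : PMF X) : Prop :=
  ∀ u, φ u = ∑' v, T v u * φ v

/-- The unnormalised weight `(|w| + 1)^(1 + α) β^|w|`. -/
noncomputable def weight {rels : Set (FreeGroup A)} (α β : ℝ) (w : State rels) : ℝ :=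
  (w.length + 1 : ℝ) ^ (1 + α) * β ^ w.length

/-- The cogrowth function: the number of freely reduced trivial words of length `n`. -/
noncomputable def cogrowth (rels : Set (FreeGroup A)) (n : ℕ) : ℕ :=
  Nat.card {w : State rels // w.length = n}

/-- The radius of convergence of the cogrowth series `∑ c(n) zⁿ`. -/
noncomputable def cogrowthRadius (rels : Set (FreeGroup A)) : ℝ≥0∞ :=
  (FormalMultilinearSeries.ofScalars ℝ fun n => (cogrowth rels n : ℝ)).radius

end TrivialWords

/-!
Write `W(w) = (|w| + 1)^(1 + α) β^|w|`. Inverting letters and relators turns every proposal `w → w'`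
into a proposal `w' → w`. The position of a left-insertion is chosen with probability
`(|w| + 1)⁻¹`, which turns `W` into the weight with exponent `α`, so both kinds of moves satisfy
detailed balance with respect to `W`. The chain is irreducible because every trivial word is a
product of conjugates of relators, and it may stay at the empty word.

For convergence, let `T` be the transition operator, which is self-adjoint with respect to `π`. The
energy `𝔼_π |Tⁿf|²` decreases, hence converges, and expressing `𝔼_π |T²ᵐf - T²ⁿf|²` through energies
shows that `T²ⁿf` converges pointwise to some `h` with `T²h = h`. Then `Th` and `h` have the same
energy, and the equality case of Jensen's inequality gives `h y = (Th) x` whenever `x → y` has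
positive probability. By irreducibility and the loop at the empty word, `h` is constant. This needs
no spectral theory and no coupling.
-/

namespace TrivialWords

section Expectation

open scoped BoundedContinuousFunction

variable {X Y : Type*}

theorem summable_toReal_mul (μ : PMF X) {f : X → ℝ} {C : ℝ} (hf : ∀ x, ‖f x‖ ≤ C) :
    Summable fun x => (μ x).toReal * f x := by
  refine .of_norm_bounded ((ENNReal.summable_toReal μ.tsum_coe_ne_top).mul_right C) fun x => ?_
  rw [norm_mul, Real.norm_of_nonneg ENNReal.toReal_nonneg]
  gcongr
  exact hf x

theorem hasSum_toReal (μ : PMF X) : HasSum (fun x => (μ x).toReal) 1 := by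
  have h := (ENNReal.summable_toReal μ.tsum_coe_ne_top).hasSum
  rwa [← ENNReal.tsum_toReal_eq μ.apply_ne_top, μ.tsum_coe, ENNReal.toReal_one] at h

theorem summable_toReal_mul_toReal_mul (μ : PMF X) (κ : X → PMF Y) {F : X × Y → ℝ} {C : ℝ}
    (hF : ∀ z, ‖F z‖ ≤ C) :
    Summable fun z : X × Y => (μ z.1).toReal * ((κ z.1 z.2).toReal * F z) := by
  have hsum : ∑' z : X × Y, μ z.1 * κ z.1 z.2 = 1 := by
    simp only [ENNReal.tsum_prod', ENNReal.tsum_mul_left, PMF.tsum_coe, mul_one]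
  refine .of_norm_bounded ((ENNReal.summable_toReal (hsum ▸ ENNReal.one_ne_top)).mul_right C)
    fun z => ?_
  rw [← mul_assoc, ← ENNReal.toReal_mul, norm_mul, Real.norm_of_nonneg ENNReal.toReal_nonneg]
  gcongr
  exact hF z

variable [TopologicalSpace X] [TopologicalSpace Y]

/-- The expectation of a bounded function under `μ`. Bounded functions on a discrete space are
encoded as bounded continuous functions, which makes them an algebra. -/
noncomputable def mean (μ : PMF X) : (X →ᵇ ℝ) →ₗ[ℝ] ℝ where
  toFun f := ∑' x, (μ x).toReal * f x
  map_add' f g := by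
    simp only [BoundedContinuousFunction.add_apply, mul_add]
    exact (summable_toReal_mul μ f.norm_coe_le_norm).tsum_add
      (summable_toReal_mul μ g.norm_coe_le_norm)
  map_smul' c f := by
    simp only [BoundedContinuousFunction.smul_apply, smul_eq_mul, mul_left_comm _ c,
      tsum_mul_left, RingHom.id_apply]

theorem mean_apply (μ : PMF X) (f : X →ᵇ ℝ) : mean μ f = ∑' x, (μ x).toReal * f x :=
  rfl

theorem mean_const (μ : PMF X) (c : ℝ) : mean μ (.const X c) = c := by
  simp only [mean_apply, BoundedContinuousFunction.const_apply, tsum_mul_right,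
    (hasSum_toReal μ).tsum_eq, one_mul]

theorem mean_pure (x : X) (f : X →ᵇ ℝ) : mean (PMF.pure x) f = f x := by
  rw [mean_apply, tsum_eq_single x fun y hy => by simp [PMF.pure_apply_of_ne _ _ hy]]
  simp

theorem mul_le_mean (μ : PMF X) {f : X →ᵇ ℝ} (hf : ∀ x, 0 ≤ f x) (x : X) :
    (μ x).toReal * f x ≤ mean μ f :=
  (summable_toReal_mul μ f.norm_coe_le_norm).le_tsum x fun y _ =>
    mul_nonneg ENNReal.toReal_nonneg (hf y)

theorem mean_nonneg (μ : PMF X) {f : X →ᵇ ℝ} (hf : ∀ x, 0 ≤ f x) : 0 ≤ mean μ f :=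
  tsum_nonneg fun x => mul_nonneg ENNReal.toReal_nonneg (hf x)

theorem eq_zero_of_mean_eq_zero {μ : PMF X} {f : X →ᵇ ℝ} (hf : ∀ x, 0 ≤ f x)
    (hmean : mean μ f = 0) {x : X} (hx : μ x ≠ 0) : f x = 0 :=
  (hf x).antisymm' <| nonpos_of_mul_nonpos_right (hmean ▸ mul_le_mean μ hf x)
    (ENNReal.toReal_pos hx (μ.apply_ne_top x))

theorem norm_mean_le (μ : PMF X) (f : X →ᵇ ℝ) : ‖mean μ f‖ ≤ ‖f‖ := by
  refine tsum_of_norm_bounded (by simpa using (hasSum_toReal μ).mul_right ‖f‖) fun x => ?_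
  rw [norm_mul, Real.norm_of_nonneg ENNReal.toReal_nonneg]
  gcongr
  exact f.norm_coe_le_norm x

theorem tendsto_mean (μ : PMF X) {F : ℕ → X →ᵇ ℝ} {g : X →ᵇ ℝ} {C : ℝ} (hF : ∀ n, ‖F n‖ ≤ C)
    (hlim : ∀ x, Tendsto (fun n => F n x) atTop (𝓝 (g x))) :
    Tendsto (fun n => mean μ (F n)) atTop (𝓝 (mean μ g)) := by
  refine tendsto_tsum_of_dominated_convergence ((hasSum_toReal μ).summable.mul_right C)
    (fun x => (hlim x).const_mul _) (.of_forall fun n x => ?_)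
  rw [norm_mul, Real.norm_of_nonneg ENNReal.toReal_nonneg]
  gcongr
  exact ((F n).norm_coe_le_norm x).trans (hF n)

theorem mean_sq_sub_mean (μ : PMF X) (f : X →ᵇ ℝ) :
    mean μ ((f - .const X (mean μ f)) ^ 2) = mean μ (f ^ 2) - mean μ f ^ 2 := by
  have hexpand : (f - .const X (mean μ f)) ^ 2 =
      f ^ 2 - (2 * mean μ f) • f + .const X (mean μ f ^ 2) := by
    ext x
    simp only [BoundedContinuousFunction.pow_apply, BoundedContinuousFunction.coe_sub,
      BoundedContinuousFunction.const_apply, Pi.sub_apply, BoundedContinuousFunction.coe_add,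
      BoundedContinuousFunction.coe_smul, smul_eq_mul, Pi.add_apply]
    ring
  rw [hexpand, map_add, map_sub, map_smul, mean_const, smul_eq_mul]
  ring

theorem sq_mean_le_mean_sq (μ : PMF X) (f : X →ᵇ ℝ) : mean μ f ^ 2 ≤ mean μ (f ^ 2) := by
  rw [← sub_nonneg, ← mean_sq_sub_mean]
  exact mean_nonneg μ fun x => by simpa using sq_nonneg _

theorem eq_mean_of_mean_sq_eq_sq_mean {μ : PMF X} {f : X →ᵇ ℝ}
    (h : mean μ f ^ 2 = mean μ (f ^ 2)) {x : X} (hx : μ x ≠ 0) : f x = mean μ f := by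
  have hvar : mean μ ((f - .const X (mean μ f)) ^ 2) = 0 := by rw [mean_sq_sub_mean, h, sub_self]
  have hzero := eq_zero_of_mean_eq_zero (fun y => by simpa using sq_nonneg _) hvar hx
  simpa [sub_eq_zero] using hzero

variable [DiscreteTopology X]

theorem mean_indicator_singleton (μ : PMF X) (x : X) :
    mean μ (.indicator {x} (isClopen_discrete _)) = (μ x).toReal := by
  rw [mean_apply, tsum_eq_single x fun y hy => by simp [hy]]
  simp

theorem tendsto_apply_of_tendsto_mean {μ : ℕ → PMF X} {ν : PMF X}
    (h : ∀ f : X →ᵇ ℝ, Tendsto (fun n => mean (μ n) f) atTop (𝓝 (mean ν f))) (x : X) :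
    Tendsto (fun n => μ n x) atTop (𝓝 (ν x)) := by
  rw [← ENNReal.tendsto_toReal_iff (fun n => (μ n).apply_ne_top x) (ν.apply_ne_top x)]
  simpa only [mean_indicator_singleton] using h (.indicator {x} (isClopen_discrete _))

theorem eq_of_mean_eq {μ ν : PMF X} (h : ∀ f, mean μ f = mean ν f) : μ = ν := by
  ext x
  rw [← ENNReal.toReal_eq_toReal_iff' (μ.apply_ne_top x) (ν.apply_ne_top x),
    ← mean_indicator_singleton, ← mean_indicator_singleton, h]

/-- The action `f ↦ (x ↦ 𝔼[f(X₁) | X₀ = x])` of a transition law `κ` on bounded functions. -/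
noncomputable def markovOp (κ : X → PMF Y) : (Y →ᵇ ℝ) →ₗ[ℝ] (X →ᵇ ℝ) where
  toFun f := .ofNormedAddCommGroupDiscrete (fun x => mean (κ x) f) ‖f‖
    fun x => norm_mean_le (κ x) f
  map_add' f g := by
    ext x
    exact map_add (mean (κ x)) f g
  map_smul' c f := by
    ext x
    exact map_smul (mean (κ x)) c f

theorem markovOp_apply (κ : X → PMF Y) (f : Y →ᵇ ℝ) (x : X) :
    markovOp κ f x = mean (κ x) f :=
  rfl

theorem norm_markovOp_le (κ : X → PMF Y) (f : Y →ᵇ ℝ) : ‖markovOp κ f‖ ≤ ‖f‖ :=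
  BoundedContinuousFunction.norm_le (norm_nonneg f) |>.2 fun x => norm_mean_le (κ x) f

theorem mean_bind (μ : PMF X) (κ : X → PMF Y) (f : Y →ᵇ ℝ) :
    mean (μ.bind κ) f = mean μ (markovOp κ f) := by
  have hbind : ∀ y, (μ.bind κ y).toReal = ∑' x, (μ x).toReal * (κ x y).toReal := fun y => by
    rw [PMF.bind_apply, ENNReal.tsum_toReal_eq fun x =>
      ENNReal.mul_ne_top (μ.apply_ne_top x) ((κ x).apply_ne_top y)]
    simp only [ENNReal.toReal_mul]
  have hsum : Summable (Function.uncurry fun x y => (μ x).toReal * ((κ x y).toReal * f y)) :=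
    summable_toReal_mul_toReal_mul μ κ (F := fun z => f z.2) fun z => f.norm_coe_le_norm z.2
  calc mean (μ.bind κ) f
      = ∑' y, ∑' x, (μ x).toReal * ((κ x y).toReal * f y) := by
        simp only [mean_apply, hbind, ← tsum_mul_right, mul_assoc]
    _ = ∑' x, ∑' y, (μ x).toReal * ((κ x y).toReal * f y) := hsum.tsum_comm
    _ = mean μ (markovOp κ f) := by simp only [mean_apply, markovOp_apply, tsum_mul_left]

theorem norm_markovOp_pow_le (T : X → PMF X) (n : ℕ) (f : X →ᵇ ℝ) :
    ‖(markovOp T ^ n) f‖ ≤ ‖f‖ := by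
  induction n with
  | zero => rfl
  | succ n ih =>
    rw [pow_succ', Module.End.mul_apply]
    exact (norm_markovOp_le T _).trans ih

theorem mean_nStep (T : X → PMF X) (n : ℕ) (u : X) (f : X →ᵇ ℝ) :
    mean (nStep T n u) f = (markovOp T ^ n) f u := by
  induction n generalizing f with
  | zero => exact mean_pure u f
  | succ n ih => rw [nStep, mean_bind, ih, pow_succ, Module.End.mul_apply]

end Expectation

section MarkovChain

open scoped BoundedContinuousFunction

variable {X : Type*}

/-- Detailed balance of the transition law `T` with respect to the weight `W`, which need not be
normalised. -/
def IsReversible (T : X → PMF X) (W : X → ℝ≥0∞) : Prop :=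
  ∀ x y, W x * T x y = W y * T y x

/-- Every state is reached from every other state with positive probability. -/
def IsIrreducible (T : X → PMF X) : Prop :=
  ∀ x y, Relation.ReflTransGen (fun a b => T a b ≠ 0) x y

variable {T : X → PMF X} {π : PMF X}

theorem IsReversible.isStationary (hrev : IsReversible T π) : IsStationary T π := fun u => by
  calc π u = ∑' v, π u * T u v := by rw [ENNReal.tsum_mul_left, (T u).tsum_coe, mul_one]
    _ = ∑' v, T v u * π v := tsum_congr fun v => by rw [hrev, mul_comm]

theorem IsReversible.normalize {W : X → ℝ≥0∞} (hrev : IsReversible T W) (h0 : tsum W ≠ 0)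
    (htop : tsum W ≠ ∞) : IsReversible T (PMF.normalize W h0 htop) := fun x y => by
  rw [PMF.normalize_apply, PMF.normalize_apply, mul_right_comm, hrev, mul_right_comm]

theorem IsReversible.mix {S : X → PMF X} {W : X → ℝ≥0∞} (hS : IsReversible S W)
    (hT : IsReversible T W) (p : ℝ) (hp : p ∈ Set.Icc (0 : ℝ) 1) :
    IsReversible (fun x => mix p hp (S x) (T x)) W := fun x y => by
  change W x * (_ * S x y + _ * T x y) = W y * (_ * S y x + _ * T y x)
  simp only [mul_add, mul_left_comm (W _), hS x y, hT x y]

namespace IsStationary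

theorem bind_eq (hst : IsStationary T π) : π.bind T = π :=
  PMF.ext fun u => by simp only [PMF.bind_apply, hst u, mul_comm]

theorem apply_ne_zero (hst : IsStationary T π) (hirr : IsIrreducible T) (x : X) : π x ≠ 0 := by
  obtain ⟨o, ho⟩ := π.support_nonempty
  induction hirr o x with
  | refl => exact ho
  | @tail y z _ hyz hy =>
    rw [hst z]
    exact fun h => mul_ne_zero hyz hy (ENNReal.tsum_eq_zero.1 h y)

variable [TopologicalSpace X] [DiscreteTopology X]

theorem mean_markovOp (hst : IsStationary T π) (f : X →ᵇ ℝ) :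
    mean π (markovOp T f) = mean π f := by
  rw [← mean_bind, hst.bind_eq]

theorem mean_markovOp_pow (hst : IsStationary T π) (n : ℕ) (f : X →ᵇ ℝ) :
    mean π ((markovOp T ^ n) f) = mean π f := by
  induction n with
  | zero => rfl
  | succ n ih => rw [pow_succ', Module.End.mul_apply, hst.mean_markovOp, ih]

theorem mean_sq_markovOp_le (hst : IsStationary T π) (f : X →ᵇ ℝ) :
    mean π (markovOp T f ^ 2) ≤ mean π (f ^ 2) := by
  rw [← hst.mean_markovOp (f ^ 2), ← sub_nonneg, ← map_sub]
  exact mean_nonneg π fun x => sub_nonneg.2 (sq_mean_le_mean_sq (T x) f)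

theorem eq_markovOp_of_mean_sq_eq (hst : IsStationary T π) {f : X →ᵇ ℝ}
    (hf : mean π (markovOp T f ^ 2) = mean π (f ^ 2)) {x y : X} (hx : π x ≠ 0)
    (hxy : T x y ≠ 0) : f y = markovOp T f x := by
  have hzero : mean π (markovOp T (f ^ 2) - markovOp T f ^ 2) = 0 := by
    rw [map_sub, hst.mean_markovOp, hf, sub_self]
  have hx : (markovOp T (f ^ 2) - markovOp T f ^ 2) x = 0 :=
    eq_zero_of_mean_eq_zero (fun z => sub_nonneg.2 (sq_mean_le_mean_sq (T z) f)) hzero hx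
  exact eq_mean_of_mean_sq_eq_sq_mean (sub_eq_zero.1 hx).symm hxy

theorem exists_tendsto_mean_sq_markovOp_pow (hst : IsStationary T π) (f : X →ᵇ ℝ) :
    ∃ L, Tendsto (fun n => mean π ((markovOp T ^ n) f ^ 2)) atTop (𝓝 L) := by
  have hanti : Antitone fun n => mean π ((markovOp T ^ n) f ^ 2) :=
    antitone_nat_of_succ_le fun n => by
      rw [pow_succ' (markovOp T), Module.End.mul_apply]
      exact hst.mean_sq_markovOp_le _
  refine ⟨_, tendsto_atTop_ciInf hanti ⟨0, ?_⟩⟩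
  rintro _ ⟨n, rfl⟩
  exact mean_nonneg π fun x => sq_nonneg _

/-- The constant sequence `mean φ f = mean φ (Tⁿ f)` tends to `mean φ (mean π f) = mean π f`. -/
theorem eq_of_tendsto_mean_nStep {φ : PMF X} (hst : IsStationary T φ)
    (hlim : ∀ (f : X →ᵇ ℝ) u, Tendsto (fun n => mean (nStep T n u) f) atTop (𝓝 (mean π f))) :
    φ = π := by
  refine eq_of_mean_eq fun f => ?_
  have h := tendsto_mean φ (F := fun n => (markovOp T ^ n) f) (g := .const X (mean π f))
    (fun n => norm_markovOp_pow_le T n f) fun u => by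
      simpa only [mean_nStep, BoundedContinuousFunction.const_apply] using hlim f u
  simp only [hst.mean_markovOp_pow, mean_const] at h
  exact tendsto_nhds_unique tendsto_const_nhds h

end IsStationary

theorem tendsto_of_even_odd {α : Type*} {u : ℕ → α} {l : Filter α}
    (heven : Tendsto (fun n => u (2 * n)) atTop l)
    (hodd : Tendsto (fun n => u (2 * n + 1)) atTop l) : Tendsto u atTop l := by
  intro s hs
  obtain ⟨N, hN⟩ := mem_atTop_sets.1 (heven hs)
  obtain ⟨M, hM⟩ := mem_atTop_sets.1 (hodd hs)
  refine mem_atTop_sets.2 ⟨2 * (N + M), fun n hn => ?_⟩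
  obtain ⟨k, rfl | rfl⟩ := n.even_or_odd'
  · exact hN k (by omega)
  · exact hM k (by omega)

section Convergence

variable [TopologicalSpace X] [DiscreteTopology X]

theorem tendsto_markovOp_apply {F : ℕ → X →ᵇ ℝ} {g : X →ᵇ ℝ} {C : ℝ} (hF : ∀ n, ‖F n‖ ≤ C)
    (hlim : ∀ x, Tendsto (fun n => F n x) atTop (𝓝 (g x))) (x : X) :
    Tendsto (fun n => markovOp T (F n) x) atTop (𝓝 (markovOp T g x)) :=
  tendsto_mean (T x) hF hlim

namespace IsReversible

theorem mean_markovOp_mul (hrev : IsReversible T π) (f g : X →ᵇ ℝ) :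
    mean π (markovOp T f * g) = mean π (f * markovOp T g) := by
  have hsum : Summable
      (Function.uncurry fun x y => (π x).toReal * ((T x y).toReal * (f y * g x))) :=
    summable_toReal_mul_toReal_mul π T (F := fun z => f z.2 * g z.1) fun z =>
      norm_mul_le_of_le (f.norm_coe_le_norm z.2) (g.norm_coe_le_norm z.1)
  have hbalance : ∀ x y, (π x).toReal * (T x y).toReal = (π y).toReal * (T y x).toReal :=
    fun x y => by rw [← ENNReal.toReal_mul, hrev, ENNReal.toReal_mul]
  calc mean π (markovOp T f * g)
      = ∑' x, ∑' y, (π x).toReal * ((T x y).toReal * (f y * g x)) := by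
        simp only [mean_apply, BoundedContinuousFunction.mul_apply, markovOp_apply, tsum_mul_left,
          ← tsum_mul_right, mul_assoc]
    _ = ∑' y, ∑' x, (π x).toReal * ((T x y).toReal * (f y * g x)) := hsum.tsum_comm.symm
    _ = ∑' y, ∑' x, (π y).toReal * (f y * ((T y x).toReal * g x)) :=
        tsum_congr fun y => tsum_congr fun x => by
          linear_combination f y * g x * hbalance x y
    _ = mean π (f * markovOp T g) := by
        simp only [mean_apply, BoundedContinuousFunction.mul_apply, markovOp_apply, tsum_mul_left]

theorem mean_markovOp_pow_mul (hrev : IsReversible T π) (m n : ℕ) (f g : X →ᵇ ℝ) :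
    mean π ((markovOp T ^ m) f * (markovOp T ^ n) g) =
      mean π (f * (markovOp T ^ (m + n)) g) := by
  induction m generalizing n with
  | zero => rw [zero_add, pow_zero, Module.End.one_apply]
  | succ m ih =>
    rw [pow_succ', Module.End.mul_apply, hrev.mean_markovOp_mul, ← Module.End.mul_apply,
      ← pow_succ', ih, Nat.add_right_comm, add_assoc]

theorem mean_sq_sub_markovOp_pow (hrev : IsReversible T π) (f : X →ᵇ ℝ) (m n : ℕ) :
    mean π (((markovOp T ^ (2 * m)) f - (markovOp T ^ (2 * n)) f) ^ 2) =
      mean π ((markovOp T ^ (2 * m)) f ^ 2) + mean π ((markovOp T ^ (2 * n)) f ^ 2) -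
        2 * mean π ((markovOp T ^ (m + n)) f ^ 2) := by
  have hcross : mean π ((markovOp T ^ (2 * m)) f * (markovOp T ^ (2 * n)) f) =
      mean π ((markovOp T ^ (m + n)) f ^ 2) := by
    rw [sq, hrev.mean_markovOp_pow_mul, hrev.mean_markovOp_pow_mul]
    congr! 4
    ring
  have hexpand : ∀ F G : X →ᵇ ℝ, (F - G) ^ 2 = F ^ 2 + G ^ 2 - (2 : ℝ) • (F * G) := fun F G => by
    ext x
    simp only [BoundedContinuousFunction.pow_apply, BoundedContinuousFunction.coe_sub,
      Pi.sub_apply, BoundedContinuousFunction.coe_add, BoundedContinuousFunction.coe_smul,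
      BoundedContinuousFunction.coe_mul, Pi.mul_apply, smul_eq_mul, Pi.add_apply]
    ring
  rw [hexpand, map_sub, map_add, map_smul, smul_eq_mul, hcross]

/-- Since `T` is self-adjoint, `𝔼_π |T²ᵐf - T²ⁿf|²` is a combination of the energies `𝔼_π |Tᵏf|²`,
which converge. -/
theorem cauchySeq_markovOp_pow_apply (hrev : IsReversible T π) {x : X} (hx : π x ≠ 0)
    (f : X →ᵇ ℝ) : CauchySeq fun n => (markovOp T ^ (2 * n)) f x := by
  obtain ⟨L, hL⟩ := hrev.isStationary.exists_tendsto_mean_sq_markovOp_pow f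
  have hmean : Tendsto (fun n : ℕ × ℕ => mean π
      (((markovOp T ^ (2 * n.1)) f - (markovOp T ^ (2 * n.2)) f) ^ 2)) atTop (𝓝 0) := by
    simp only [hrev.mean_sq_sub_markovOp_pow, ← prod_atTop_atTop_eq]
    have hadd : Tendsto (fun n : ℕ × ℕ => n.1 + n.2) (atTop ×ˢ atTop) atTop :=
      tendsto_fst.atTop_add_atTop tendsto_snd
    rw [show (0 : ℝ) = L + L - 2 * L by ring]
    exact ((hL.comp (tendsto_fst.const_mul_atTop' two_pos)).add
      (hL.comp (tendsto_snd.const_mul_atTop' two_pos))).sub ((hL.comp hadd).const_mul 2)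
  have hπx : 0 < (π x).toReal := ENNReal.toReal_pos hx (π.apply_ne_top x)
  rw [cauchySeq_iff_tendsto_dist_atTop_0]
  have hsqrt := (hmean.div_const (π x).toReal).sqrt
  rw [zero_div, Real.sqrt_zero] at hsqrt
  refine squeeze_zero (fun n => dist_nonneg) (fun n => Real.abs_le_sqrt ?_) hsqrt
  rw [le_div_iff₀' hπx]
  exact mul_le_mean π (f := (_ - _) ^ 2) (fun y => sq_nonneg _) x

theorem exists_tendsto_markovOp_pow_even (hrev : IsReversible T π) (hπ : ∀ x, π x ≠ 0)
    (f : X →ᵇ ℝ) :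
    ∃ h : X →ᵇ ℝ, ∀ x, Tendsto (fun n => (markovOp T ^ (2 * n)) f x) atTop (𝓝 (h x)) := by
  choose h hh using fun x =>
    cauchySeq_tendsto_of_complete (hrev.cauchySeq_markovOp_pow_apply (hπ x) f)
  have hbound : ∀ x, ‖h x‖ ≤ ‖f‖ := fun x => le_of_tendsto (hh x).norm <| .of_forall fun n =>
    (BoundedContinuousFunction.norm_coe_le_norm _ x).trans (norm_markovOp_pow_le T _ f)
  exact ⟨.ofNormedAddCommGroupDiscrete h ‖f‖ hbound, hh⟩

/-- Two steps acting trivially on `h` forces `h y = T h x` along every edge `x → y`. Hence the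
pair `(h, T h)` is swapped along edges, and the loop at `o` makes its two entries agree. -/
theorem eq_const_of_markovOp_markovOp_eq (hrev : IsReversible T π) (hirr : IsIrreducible T)
    {o : X} (hloop : T o o ≠ 0) {h : X →ᵇ ℝ} (hh : markovOp T (markovOp T h) = h) :
    h = .const X (mean π h) := by
  have hπ := hrev.isStationary.apply_ne_zero hirr
  have hsymm : ∀ {x y}, T x y ≠ 0 → T y x ≠ 0 := fun {x y} hxy hyx =>
    mul_ne_zero (hπ x) hxy (by rw [hrev, hyx, mul_zero])
  have hedge : ∀ {x y}, T x y ≠ 0 → h y = markovOp T h x := fun {x y} =>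
    hrev.isStationary.eq_markovOp_of_mean_sq_eq (by rw [sq, hrev.mean_markovOp_mul, hh, sq]) (hπ x)
  have hconst : ∀ x, h x = h o ∧ markovOp T h x = h o := fun x => by
    induction hirr o x with
    | refl => exact ⟨rfl, (hedge hloop).symm⟩
    | tail _ hxy ih => exact ⟨(hedge hxy).trans ih.2, (hedge (hsymm hxy)).symm.trans ih.1⟩
  have ho : h = .const X (h o) := BoundedContinuousFunction.ext fun x => (hconst x).1
  rw [ho, mean_const]

theorem tendsto_markovOp_pow_apply (hrev : IsReversible T π) (hirr : IsIrreducible T) {o : X}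
    (hloop : T o o ≠ 0) (f : X →ᵇ ℝ) (x : X) :
    Tendsto (fun n => (markovOp T ^ n) f x) atTop (𝓝 (mean π f)) := by
  have hst := hrev.isStationary
  obtain ⟨h, heven⟩ := hrev.exists_tendsto_markovOp_pow_even (hst.apply_ne_zero hirr) f
  have hbound : ∀ n, ‖(markovOp T ^ n) f‖ ≤ ‖f‖ := fun n => norm_markovOp_pow_le T n f
  have hodd : ∀ x, Tendsto (fun n => (markovOp T ^ (2 * n + 1)) f x) atTop
      (𝓝 (markovOp T h x)) := by
    simp only [pow_succ' _ (2 * _), Module.End.mul_apply]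
    exact tendsto_markovOp_apply (fun n => hbound _) heven
  have hinv : markovOp T (markovOp T h) = h := by
    ext x
    have hshift := (tendsto_add_atTop_iff_nat 1).2 (heven x)
    simp only [mul_add, mul_one, pow_succ' _ (2 * _ + 1), Module.End.mul_apply] at hshift
    exact tendsto_nhds_unique (tendsto_markovOp_apply (fun n => hbound _) hodd x) hshift
  have hmean : mean π h = mean π f := by
    have hlim := tendsto_mean π (fun n => hbound (2 * n)) heven
    simp only [hst.mean_markovOp_pow] at hlim
    exact tendsto_nhds_unique hlim tendsto_const_nhds
  have hconst : h = .const X (mean π f) :=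
    hmean ▸ hrev.eq_const_of_markovOp_markovOp_eq hirr hloop hinv
  refine tendsto_of_even_odd ?_ ?_
  · simpa [hconst] using heven x
  · simpa [hconst, markovOp_apply, mean_const] using hodd x

end IsReversible

end Convergence

namespace IsReversible

theorem tendsto_nStep (hrev : IsReversible T π) (hirr : IsIrreducible T) {o : X}
    (hloop : T o o ≠ 0) (u v : X) : Tendsto (fun n => nStep T n u v) atTop (𝓝 (π v)) := by
  let : TopologicalSpace X := ⊥
  have : DiscreteTopology X := ⟨rfl⟩
  refine tendsto_apply_of_tendsto_mean (fun f => ?_) v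
  simpa only [mean_nStep] using hrev.tendsto_markovOp_pow_apply hirr hloop f u

theorem eq_of_isStationary (hrev : IsReversible T π) (hirr : IsIrreducible T) {o : X}
    (hloop : T o o ≠ 0) {φ : PMF X} (hφ : IsStationary T φ) : φ = π := by
  let : TopologicalSpace X := ⊥
  have : DiscreteTopology X := ⟨rfl⟩
  refine hφ.eq_of_tendsto_mean_nStep fun f u => ?_
  simpa only [mean_nStep] using hrev.tendsto_markovOp_pow_apply hirr hloop f u

end IsReversible

end MarkovChain

section Moves

variable {A : Type*} {rels : Set (FreeGroup A)}

/-- The element of the free group represented by a state. -/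
def State.toFreeGroup (w : State rels) : FreeGroup A := FreeGroup.mk w.1

theorem State.mk_toFreeGroup (w : State rels) : PresentedGroup.mk rels w.toFreeGroup = 1 :=
  w.2.2

theorem State.toFreeGroup_mem_normalClosure (w : State rels) :
    w.toFreeGroup ∈ Subgroup.normalClosure rels :=
  PresentedGroup.mk_eq_one_iff.1 w.mk_toFreeGroup

theorem State.toFreeGroup_injective :
    Function.Injective (State.toFreeGroup : State rels → FreeGroup A) := fun v w h => by
  classical
  refine Subtype.ext ?_
  rw [← v.2.1.reduce_eq, ← w.2.1.reduce_eq]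
  exact FreeGroup.reduce.sound h

theorem mk_letterInv (x : A × Bool) : FreeGroup.mk [letterInv x] = (FreeGroup.mk [x])⁻¹ := by
  simp [letterInv, FreeGroup.invRev]

theorem letterInv_involutive : Function.Involutive (letterInv : A × Bool → A × Bool) :=
  fun x => by simp [letterInv]

theorem State.exists_eq_append (w : State rels) (m : Fin (w.length + 1)) :
    ∃ u v, w.1 = u ++ v ∧ v.length = m :=
  ⟨_, _, (List.take_append_drop (w.length - m) w.1).symm,
    List.length_drop.trans (Nat.sub_sub_self m.is_le)⟩

theorem State.take_drop_of_eq_append {w : State rels} {u v : Word A} {m : ℕ} (hw : w.1 = u ++ v)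
    (hm : v.length = m) : w.1.take (w.length - m) = u ∧ w.1.drop (w.length - m) = v := by
  have hlen : w.length - m = u.length := by
    rw [State.length, hw, List.length_append, hm, Nat.add_sub_cancel]
  rw [hlen, hw]
  exact ⟨List.take_left, List.drop_left⟩

/-- `w = u v` and `w' = u' v` with `|v| = m`, where `u' = u g` in the free group: the effect of a
non-trivial left-insertion of `g` at position `m`, in a form that does not distinguish `w`
from `w'`. -/
def InsertionRel (w w' : State rels) (g : FreeGroup A) (m : ℕ) : Prop :=
  ∃ u u' v : Word A, w.1 = u ++ v ∧ w'.1 = u' ++ v ∧ v.length = m ∧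
    FreeGroup.mk u' = FreeGroup.mk u * g

theorem InsertionRel.symm {w w' : State rels} {g : FreeGroup A} {m : ℕ}
    (h : InsertionRel w w' g m) : InsertionRel w' w g⁻¹ m := by
  obtain ⟨u, u', v, hw, hw', hm, hg⟩ := h
  exact ⟨u', u, v, hw', hw, hm, by rw [hg, mul_inv_cancel_right]⟩

theorem insertionRel_inv_iff {w w' : State rels} {g : FreeGroup A} {m : ℕ} :
    InsertionRel w' w g⁻¹ m ↔ InsertionRel w w' g m :=
  ⟨fun h => inv_inv g ▸ h.symm, InsertionRel.symm⟩

theorem InsertionRel.le_length {w w' : State rels} {g : FreeGroup A} {m : ℕ}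
    (h : InsertionRel w w' g m) : m ≤ w.length := by
  obtain ⟨u, u', v, hw, -, rfl, -⟩ := h
  simp only [State.length, hw, List.length_append, Nat.le_add_left]

variable [DecidableEq A]

/-- The state given by a trivial element of the free group. -/
def State.ofFreeGroup (g : FreeGroup A) (hg : PresentedGroup.mk rels g = 1) : State rels :=
  ⟨g.toWord, FreeGroup.isReduced_toWord, by rwa [FreeGroup.mk_toWord]⟩

theorem State.toFreeGroup_ofFreeGroup (g : FreeGroup A) (hg : PresentedGroup.mk rels g = 1) :
    (State.ofFreeGroup g hg).toFreeGroup = g :=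
  FreeGroup.mk_toWord

theorem relatorInv_involutive :
    Function.Involutive (relatorInv : relatorSet rels → relatorSet rels) :=
  fun _ => Subtype.ext FreeGroup.invRev_invRev

theorem mk_relatorInv (R : relatorSet rels) :
    FreeGroup.mk (relatorInv R).1 = (FreeGroup.mk R.1)⁻¹ :=
  FreeGroup.inv_mk.symm

theorem toFreeGroup_conjMove (w : State rels) (x : A × Bool) :
    (conjMove w x).toFreeGroup = FreeGroup.mk [x] * w.toFreeGroup * (FreeGroup.mk [x])⁻¹ := by
  rw [State.toFreeGroup, conjMove, mk_reduce, ← mk_letterInv, State.toFreeGroup,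
    FreeGroup.mul_mk, FreeGroup.mul_mk]
  rfl

theorem conjMove_eq_iff (w w' : State rels) (x : A × Bool) :
    conjMove w x = w' ↔ conjMove w' (letterInv x) = w := by
  rw [← State.toFreeGroup_injective.eq_iff, ← State.toFreeGroup_injective.eq_iff,
    toFreeGroup_conjMove, toFreeGroup_conjMove, mk_letterInv]
  constructor <;> rintro h <;> rw [← h] <;> group

section LeftInsert

variable {w w' : State rels} {R : relatorSet rels} {m : Fin (w.length + 1)} {u v : Word A}

theorem leftInsert_val (hw : w.1 = u ++ v) (hm : v.length = m)
    (h : FreeGroup.IsReduced (FreeGroup.reduce (u ++ R.1) ++ v)) :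
    (leftInsert w R m).1 = FreeGroup.reduce (u ++ R.1) ++ v := by
  obtain ⟨rfl, rfl⟩ := State.take_drop_of_eq_append hw hm
  exact congrArg Subtype.val (dif_pos h.reduce_eq)

theorem leftInsert_eq_self (hw : w.1 = u ++ v) (hm : v.length = m)
    (h : ¬ FreeGroup.IsReduced (FreeGroup.reduce (u ++ R.1) ++ v)) : leftInsert w R m = w := by
  obtain ⟨rfl, rfl⟩ := State.take_drop_of_eq_append hw hm
  exact dif_neg fun h' => h (FreeGroup.IsReduced.of_reduce_eq h')

theorem leftInsert_eq_iff (hne : w ≠ w') :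
    leftInsert w R m = w' ↔ InsertionRel w w' (FreeGroup.mk R.1) m := by
  constructor
  · intro h
    obtain ⟨u, v, hw, hm⟩ := w.exists_eq_append m
    have hred : FreeGroup.IsReduced (FreeGroup.reduce (u ++ R.1) ++ v) := by
      by_contra hred
      exact hne ((leftInsert_eq_self hw hm hred).symm.trans h)
    refine ⟨u, FreeGroup.reduce (u ++ R.1), v, hw, ?_, hm, ?_⟩
    · rw [← h, leftInsert_val hw hm hred]
    · rw [mk_reduce, FreeGroup.mul_mk]
  · rintro ⟨u, u', v, hw, hw', hm, hu'⟩
    have hred : FreeGroup.IsReduced u' :=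
      w'.2.1.infix (hw' ▸ (List.prefix_append u' v).isInfix)
    have hreduce : FreeGroup.reduce (u ++ R.1) = u' := by
      rw [← hred.reduce_eq]
      exact FreeGroup.reduce.sound (by rw [hu', FreeGroup.mul_mk])
    have hval : FreeGroup.reduce (u ++ R.1) ++ v = w'.1 := by rw [hreduce, hw']
    exact Subtype.ext ((leftInsert_val hw hm (hval ▸ w'.2.1)).trans hval)

theorem toFreeGroup_leftInsert_zero (w : State rels) (R : relatorSet rels) :
    (leftInsert w R 0).toFreeGroup = w.toFreeGroup * FreeGroup.mk R.1 := by
  have hred : FreeGroup.IsReduced (FreeGroup.reduce (w.1 ++ R.1) ++ []) := by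
    rw [List.append_nil]
    exact isReduced_reduce _
  rw [State.toFreeGroup, leftInsert_val w.1.append_nil.symm rfl hred, List.append_nil, mk_reduce,
    State.toFreeGroup, FreeGroup.mul_mk]

end LeftInsert

theorem sum_leftInsert {M : Type*} [AddCommMonoid M] [DecidableEq (State rels)]
    {w w' : State rels} (hne : w ≠ w') (R : relatorSet rels) (c : M) :
    ∑ m, (if leftInsert w R m = w' then c else 0) =
      ∑ m, if leftInsert w' (relatorInv R) m = w then c else 0 := by
  classical
  simp only [leftInsert_eq_iff hne, leftInsert_eq_iff hne.symm, mk_relatorInv,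
    insertionRel_inv_iff, ← Finset.sum_filter]
  have hle : ∀ {m}, InsertionRel w w' (FreeGroup.mk R.1) m → m < w'.length + 1 := fun h =>
    Nat.lt_succ_of_le h.symm.le_length
  refine Finset.sum_bij' (fun m hm => ⟨m, hle (Finset.mem_filter.1 hm).2⟩)
    (fun m hm => ⟨m, Nat.lt_succ_of_le (Finset.mem_filter.1 hm).2.le_length⟩) ?_ ?_ ?_ ?_ ?_ <;>
    simp

end Moves

section Balance

variable {A : Type*} {rels : Set (FreeGroup A)} {α β : ℝ}

theorem weight_pos (hβ : 0 < β) (w : State rels) : 0 < weight α β w := by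
  unfold weight
  positivity

theorem weight_sub_one (w : State rels) :
    weight (α - 1) β w = weight α β w / (w.length + 1) := by
  rw [weight, weight, ← add_sub_assoc, Real.rpow_sub_one (by positivity), div_mul_eq_mul_div]

theorem ofReal_weight_mul_inv (w : State rels) :
    ENNReal.ofReal (weight α β w) * ((w.length + 1 : ℕ) : ℝ≥0∞)⁻¹ =
      ENNReal.ofReal (weight (α - 1) β w) := by
  rw [weight_sub_one, ENNReal.ofReal_div_of_pos (by positivity), div_eq_mul_inv,
    ← Nat.cast_succ, ENNReal.ofReal_natCast]

theorem weight_mul_acceptProb (hβ : 0 < β) (w w' : State rels) :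
    weight α β w * acceptProb (1 + α) β w w' = min (weight α β w) (weight α β w') := by
  have hw : 0 < weight α β w := weight_pos hβ w
  rw [acceptProb, div_mul_div_comm, ← weight, ← weight, mul_min_of_nonneg _ _ hw.le, mul_one,
    mul_div_cancel₀ _ hw.ne']

theorem acceptProb_pos (e : ℝ) (hβ : 0 < β) (w w' : State rels) : 0 < acceptProb e β w w' := by
  unfold acceptProb
  positivity

theorem mix_apply {X : Type*} (p : ℝ) (hp : p ∈ Set.Icc (0 : ℝ) 1) (μ ν : PMF X) (x : X) :
    mix p hp μ ν x = ENNReal.ofReal p * μ x + ENNReal.ofReal (1 - p) * ν x :=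
  rfl

variable [DecidableEq A] (hβ : β ∈ Set.Ioo (0 : ℝ) 1)

theorem acceptReject_apply_of_ne [DecidableEq (State rels)] (e : ℝ) {w w' : State rels}
    (hne : w ≠ w') (z : State rels) : acceptReject e β hβ w z w' =
      if z = w' then ENNReal.ofReal (acceptProb e β w w') else 0 := by
  rw [acceptReject, mix_apply, PMF.pure_apply, PMF.pure_apply, if_neg hne.symm, mul_zero, add_zero]
  obtain rfl | hz := eq_or_ne z w'
  · rw [if_pos rfl, if_pos rfl, mul_one]
  · rw [if_neg hz.symm, if_neg hz, mul_zero]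

theorem acceptReject_apply_self_ne_zero (e : ℝ) (w w' : State rels) :
    acceptReject e β hβ w w' w' ≠ 0 := by
  rw [acceptReject, mix_apply, PMF.pure_apply, if_pos rfl, mul_one]
  exact fun h => (ENNReal.ofReal_pos.2 (acceptProb_pos e hβ.1 w w')).ne' (add_eq_zero.1 h).1

theorem weight_mul_acceptReject [DecidableEq (State rels)] {w w' : State rels} (hne : w ≠ w')
    (z : State rels) :
    ENNReal.ofReal (weight α β w) * acceptReject (1 + α) β hβ w z w' =
      if z = w' then ENNReal.ofReal (min (weight α β w) (weight α β w')) else 0 := by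
  rw [acceptReject_apply_of_ne hβ _ hne, mul_ite, mul_zero,
    ← ENNReal.ofReal_mul (weight_pos hβ.1 w).le, weight_mul_acceptProb hβ.1]

/-- One step of the chain, given that a conjugation is proposed. -/
noncomputable def conjStep [Fintype A] [Nonempty A] (α : ℝ) (hβ : β ∈ Set.Ioo (0 : ℝ) 1)
    (w : State rels) : PMF (State rels) :=
  (PMF.uniformOfFintype (A × Bool)).bind fun x => acceptReject (1 + α) β hβ w (conjMove w x)

/-- One step of the chain, given that a left-insertion is proposed. -/
noncomputable def insertStep (α : ℝ) (hβ : β ∈ Set.Ioo (0 : ℝ) 1) (P : PMF (relatorSet rels))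
    (w : State rels) : PMF (State rels) :=
  P.bind fun R => (PMF.uniformOfFintype (Fin (w.length + 1))).bind fun m =>
    acceptReject α β hβ w (leftInsert w R m)

/-- The factor `(|w| + 1)⁻¹` from the choice of the position turns the exponent `1 + α` of the
weight into the exponent `α` used to accept left-insertions. -/
theorem weight_mul_insertStep [DecidableEq (State rels)] (P : PMF (relatorSet rels))
    {w w' : State rels} (hne : w ≠ w') :
    ENNReal.ofReal (weight α β w) * insertStep α hβ P w w' =
      ∑' R, P R * ∑ m, if leftInsert w R m = w' then
        ENNReal.ofReal (min (weight (α - 1) β w) (weight (α - 1) β w')) else 0 := by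
  have hacc := weight_mul_acceptReject (α := α - 1) hβ hne
  rw [add_sub_cancel] at hacc
  simp only [insertStep, PMF.bind_apply, PMF.uniformOfFintype_apply, Fintype.card_fin,
    tsum_fintype, ← ENNReal.tsum_mul_left]
  refine tsum_congr fun R => ?_
  rw [mul_left_comm, ← Finset.mul_sum, ← mul_assoc (ENNReal.ofReal _), ofReal_weight_mul_inv,
    Finset.mul_sum]
  simp only [hacc]

theorem insertStep_isReversible {P : PMF (relatorSet rels)} (hP : ∀ R, P R = P (relatorInv R)) :
    IsReversible (insertStep α hβ P) fun w => ENNReal.ofReal (weight α β w) := fun w w' => by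
  classical
  obtain rfl | hne := eq_or_ne w w'
  · rfl
  rw [weight_mul_insertStep hβ P hne, weight_mul_insertStep hβ P hne.symm, min_comm,
    ← relatorInv_involutive.toPerm.tsum_eq]
  refine tsum_congr fun R => ?_
  rw [Function.Involutive.coe_toPerm, ← hP, ← sum_leftInsert hne.symm]

variable [Fintype A] [Nonempty A]

theorem conjStep_isReversible :
    IsReversible (conjStep α hβ) fun w : State rels => ENNReal.ofReal (weight α β w) :=
  fun w w' => by
  classical
  obtain rfl | hne := eq_or_ne w w'
  · rfl
  simp only [conjStep, PMF.bind_apply, PMF.uniformOfFintype_apply, ← ENNReal.tsum_mul_left,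
    mul_left_comm (ENNReal.ofReal _), weight_mul_acceptReject hβ hne,
    weight_mul_acceptReject hβ hne.symm]
  rw [← letterInv_involutive.toPerm.tsum_eq]
  simp only [Function.Involutive.coe_toPerm, ← conjMove_eq_iff, min_comm]

variable {pc : ℝ} (hpc : pc ∈ Set.Ioo (0 : ℝ) 1) {P : PMF (relatorSet rels)}

theorem step_isReversible (hP : ∀ R, P R = P (relatorInv R)) :
    IsReversible (step pc hpc α β hβ P) fun w => ENNReal.ofReal (weight α β w) :=
  (conjStep_isReversible hβ).mix (insertStep_isReversible hβ hP) pc _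

theorem step_conjMove_ne_zero (w : State rels) (x : A × Bool) :
    step pc hpc α β hβ P w (conjMove w x) ≠ 0 := by
  rw [step, mix_apply]
  refine fun h => mul_ne_zero (ENNReal.ofReal_pos.2 hpc.1).ne' ?_ (add_eq_zero.1 h).1
  rw [← PMF.mem_support_iff, PMF.mem_support_bind_iff]
  exact ⟨x, PMF.mem_support_uniformOfFintype x, acceptReject_apply_self_ne_zero hβ _ _ _⟩

theorem step_leftInsert_ne_zero (hP : ∀ R, P R ≠ 0) (w : State rels) (R : relatorSet rels)
    (m : Fin (w.length + 1)) : step pc hpc α β hβ P w (leftInsert w R m) ≠ 0 := by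
  rw [step, mix_apply]
  refine fun h => mul_ne_zero (ENNReal.ofReal_pos.2 (sub_pos.2 hpc.2)).ne' ?_ (add_eq_zero.1 h).2
  simp only [← PMF.mem_support_iff, PMF.mem_support_bind_iff]
  exact ⟨R, hP R, m, PMF.mem_support_uniformOfFintype m, acceptReject_apply_self_ne_zero hβ _ _ _⟩

end Balance

section Irreducible

variable {A : Type*} [DecidableEq A] {rels : Set (FreeGroup A)}

/-- Two states are adjacent if they are related by a conjugation or by a left-insertion at the
end of the word. -/
def Adjacent (w w' : State rels) : Prop :=
  (∃ x, conjMove w x = w') ∨ ∃ R, leftInsert w R 0 = w'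

theorem Adjacent.symm {w w' : State rels} (h : Adjacent w w') : Adjacent w' w := by
  rcases h with ⟨x, hx⟩ | ⟨R, hR⟩
  · exact .inl ⟨letterInv x, (conjMove_eq_iff w w' x).1 hx⟩
  · refine .inr ⟨relatorInv R, State.toFreeGroup_injective ?_⟩
    rw [toFreeGroup_leftInsert_zero, ← hR, toFreeGroup_leftInsert_zero, mk_relatorInv,
      mul_inv_cancel_right]

theorem reflTransGen_adjacent_of_eq_conj (g : FreeGroup A) {w w' : State rels}
    (h : w'.toFreeGroup = g * w.toFreeGroup * g⁻¹) : Relation.ReflTransGen Adjacent w w' := by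
  rw [← FreeGroup.mk_toWord (x := g)] at h
  generalize g.toWord = L at h
  induction L generalizing w' with
  | nil =>
    obtain rfl : w' = w := State.toFreeGroup_injective (by simpa [← FreeGroup.one_eq_mk] using h)
    rfl
  | cons x L ih =>
    have hcons : FreeGroup.mk (x :: L) = FreeGroup.mk [x] * FreeGroup.mk L :=
      (FreeGroup.mul_mk (L₁ := [x]) (L₂ := L)).symm
    have hpred : (conjMove w' (letterInv x)).toFreeGroup =
        FreeGroup.mk L * w.toFreeGroup * (FreeGroup.mk L)⁻¹ := by
      rw [toFreeGroup_conjMove, mk_letterInv, h, hcons]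
      group
    exact (ih hpred).tail (.inl ⟨x, (conjMove_eq_iff _ _ x).2 rfl⟩)

theorem toWord_mem_relatorSet {r : FreeGroup A} (hr : r ∈ rels) : r.toWord ∈ relatorSet rels :=
  ⟨r, hr, r.toWord, .inl (List.IsRotated.refl _), (FreeGroup.reduce_toWord r).symm⟩

/-- Conjugate `w` by `c⁻¹`, append `r`, and conjugate back. -/
theorem reflTransGen_adjacent_of_eq_mul_conj {r : FreeGroup A} (hr : r ∈ rels) (c : FreeGroup A)
    {w w' : State rels} (h : w'.toFreeGroup = w.toFreeGroup * (c * r * c⁻¹)) :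
    Relation.ReflTransGen Adjacent w w' := by
  have hconj : PresentedGroup.mk rels (c⁻¹ * w.toFreeGroup * c) = 1 := by
    rw [map_mul, map_mul, w.mk_toFreeGroup, mul_one, ← map_mul, inv_mul_cancel, map_one]
  have hv := State.toFreeGroup_ofFreeGroup _ hconj
  set v : State rels := .ofFreeGroup _ hconj
  have hwv : Relation.ReflTransGen Adjacent w v :=
    reflTransGen_adjacent_of_eq_conj c⁻¹ (by rw [hv, inv_inv])
  refine (hwv.tail (.inr ⟨⟨_, toWord_mem_relatorSet hr⟩, rfl⟩)).trans
    (reflTransGen_adjacent_of_eq_conj c ?_)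
  rw [h, toFreeGroup_leftInsert_zero, hv, FreeGroup.mk_toWord]
  group

theorem reflTransGen_adjacent_of_eq_mul {g : FreeGroup A} (hg : g ∈ Subgroup.normalClosure rels)
    {w w' : State rels} (h : w'.toFreeGroup = w.toFreeGroup * g) :
    Relation.ReflTransGen Adjacent w w' := by
  induction hg using Subgroup.closure_induction generalizing w w' with
  | mem g hg =>
    obtain ⟨r, hr, hrg⟩ := Group.mem_conjugatesOfSet_iff.1 hg
    obtain ⟨c, rfl⟩ := isConj_iff.1 hrg
    exact reflTransGen_adjacent_of_eq_mul_conj hr c h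
  | one =>
    obtain rfl : w' = w := State.toFreeGroup_injective (by rw [h, mul_one])
    rfl
  | mul g k hg _ ihg ihk =>
    have hwg : PresentedGroup.mk rels (w.toFreeGroup * g) = 1 :=
      PresentedGroup.mk_eq_one_iff.2 (mul_mem w.toFreeGroup_mem_normalClosure hg)
    have hv := State.toFreeGroup_ofFreeGroup _ hwg
    exact (ihg hv).trans (ihk (by rw [h, hv, mul_assoc]))
  | inv g _ ih =>
    have : Std.Symm (Adjacent (rels := rels)) := ⟨fun _ _ => Adjacent.symm⟩
    exact Std.Symm.symm _ _ (ih (by rw [h, inv_mul_cancel_right]))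

theorem reflTransGen_adjacent (w w' : State rels) : Relation.ReflTransGen Adjacent w w' :=
  reflTransGen_adjacent_of_eq_mul (mul_mem (inv_mem w.toFreeGroup_mem_normalClosure)
    w'.toFreeGroup_mem_normalClosure) (mul_inv_cancel_left _ _).symm

variable [Fintype A] [Nonempty A] {pc α β : ℝ} (hβ : β ∈ Set.Ioo (0 : ℝ) 1)
  (hpc : pc ∈ Set.Ioo (0 : ℝ) 1) {P : PMF (relatorSet rels)}

theorem step_isIrreducible (hP : ∀ R, P R ≠ 0) : IsIrreducible (step pc hpc α β hβ P) :=
  fun w w' => by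
  refine Relation.ReflTransGen.mono ?_ _ _ (reflTransGen_adjacent w w')
  rintro u _ (⟨x, rfl⟩ | ⟨R, rfl⟩)
  · exact step_conjMove_ne_zero hβ hpc u x
  · exact step_leftInsert_ne_zero hβ hpc hP u R 0

theorem exists_step_self_ne_zero : ∃ e, step pc hpc α β hβ P e e ≠ 0 := by
  obtain ⟨x⟩ : Nonempty (A × Bool) := inferInstance
  obtain ⟨e, he⟩ : ∃ e : State rels, e.toFreeGroup = 1 :=
    ⟨.ofFreeGroup 1 (map_one (PresentedGroup.mk rels)), State.toFreeGroup_ofFreeGroup _ _⟩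
  have hfix : conjMove e x = e := State.toFreeGroup_injective (by
    rw [toFreeGroup_conjMove, he, mul_one, mul_inv_cancel])
  refine ⟨e, ?_⟩
  have hstep := step_conjMove_ne_zero (α := α) hβ hpc (P := P) e x
  rwa [hfix] at hstep

end Irreducible

section Cogrowth

theorem summable_add_one_pow_mul_geometric {r : ℝ} (k : ℕ) (hr : ‖r‖ < 1) :
    Summable fun n : ℕ => ((n : ℝ) + 1) ^ k * r ^ n := by
  simp only [add_pow, one_pow, mul_one, Finset.sum_mul, mul_right_comm _ (Nat.cast _)]
  exact summable_sum fun i _ => (summable_pow_mul_geometric_of_norm_lt_one i hr).mul_right _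

variable {A : Type*} [Finite A] {rels : Set (FreeGroup A)} {β : ℝ}

theorem finite_length_eq (n : ℕ) : Finite {w : State rels // w.length = n} :=
  Finite.of_injective (β := List.Vector (A × Bool) n) (fun w => ⟨w.1.1, w.2⟩) fun _ _ h =>
    Subtype.ext (Subtype.ext (congrArg List.Vector.toList h))

theorem summable_weight_iff (α : ℝ) (hβ : 0 < β) :
    (Summable fun w : State rels => weight α β w) ↔
      Summable fun n : ℕ => (cogrowth rels n : ℝ) * (((n : ℝ) + 1) ^ (1 + α) * β ^ n) := by
  have hfiber : ∀ n, ∑' w : {w : State rels // w.length = n}, weight α β w.1 =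
      (cogrowth rels n : ℝ) * (((n : ℝ) + 1) ^ (1 + α) * β ^ n) := fun n => by
    have hw : ∀ w : {w : State rels // w.length = n},
        weight α β w.1 = ((n : ℝ) + 1) ^ (1 + α) * β ^ n := fun w => by rw [weight, w.2]
    rw [tsum_congr hw, tsum_const, nsmul_eq_mul, cogrowth]
  have hfinite : ∀ n, Summable fun w : {w : State rels // w.length = n} => weight α β w.1 :=
    fun n => have := finite_length_eq (rels := rels) n; .of_finite
  have hnonneg : ∀ z : Σ n, {w : State rels // w.length = n}, 0 ≤ weight α β z.2.1 :=
    fun z => (weight_pos hβ z.2.1).le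
  calc (Summable fun w : State rels => weight α β w)
      ↔ Summable fun z : Σ n, {w : State rels // w.length = n} => weight α β z.2.1 :=
        ((Equiv.sigmaFiberEquiv (State.length (rels := rels))).summable_iff
          (f := fun w => weight α β w)).symm
    _ ↔ _ := by
        rw [summable_sigma_of_nonneg hnonneg, and_iff_right hfinite]
        simp only [hfiber]

theorem summable_weight_of_lt_cogrowthRadius (α : ℝ) (hβ : 0 < β)
    (h : ENNReal.ofReal β < cogrowthRadius rels) :
    Summable fun w : State rels => weight α β w := by
  obtain ⟨a, ha, C, -, hbound⟩ := FormalMultilinearSeries.norm_mul_pow_le_mul_pow_of_lt_radius _ h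
  simp only [FormalMultilinearSeries.ofScalars_norm, Real.norm_natCast,
    Real.coe_toNNReal _ hβ.le] at hbound
  obtain ⟨k, hk⟩ := exists_nat_ge (1 + α)
  have hgeom : Summable fun n : ℕ => C * (((n : ℝ) + 1) ^ k * a ^ n) :=
    (summable_add_one_pow_mul_geometric k ((Real.norm_of_nonneg ha.1.le).trans_lt ha.2)).mul_left C
  refine (summable_weight_iff α hβ).2
    (.of_nonneg_of_le (fun n => by positivity) (fun n => ?_) hgeom)
  have hpow : ((n : ℝ) + 1) ^ (1 + α) ≤ ((n : ℝ) + 1) ^ k := by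
    rw [← Real.rpow_natCast]
    exact Real.rpow_le_rpow_of_exponent_le (le_add_of_nonneg_left n.cast_nonneg) hk
  calc (cogrowth rels n : ℝ) * (((n : ℝ) + 1) ^ (1 + α) * β ^ n)
      = ((n : ℝ) + 1) ^ (1 + α) * (cogrowth rels n * β ^ n) := by ring
    _ ≤ ((n : ℝ) + 1) ^ k * (C * a ^ n) :=
        mul_le_mul hpow (hbound n) (by positivity) (by positivity)
    _ = C * (((n : ℝ) + 1) ^ k * a ^ n) := by ring

end Cogrowth

section Gibbs

variable {A : Type*} {rels : Set (FreeGroup A)} {α β : ℝ}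

theorem tsum_ofReal_weight (hβ : 0 < β) (hZ : Summable fun w : State rels => weight α β w) :
    ∑' w : State rels, ENNReal.ofReal (weight α β w) =
      ENNReal.ofReal (∑' w : State rels, weight α β w) :=
  (ENNReal.ofReal_tsum_of_nonneg (fun w => (weight_pos hβ w).le) hZ).symm

theorem tsum_ofReal_weight_ne_zero (hβ : 0 < β) :
    ∑' w : State rels, ENNReal.ofReal (weight α β w) ≠ 0 := fun h =>
  (ENNReal.ofReal_pos.2 (weight_pos hβ _)).ne'
    (ENNReal.tsum_eq_zero.1 h ⟨[], FreeGroup.IsReduced.nil, map_one _⟩)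

/-- The distribution on the states with density proportional to `weight α β`. -/
noncomputable def gibbs (hβ : 0 < β) (hZ : Summable fun w : State rels => weight α β w) :
    PMF (State rels) :=
  .normalize (fun w => ENNReal.ofReal (weight α β w)) (tsum_ofReal_weight_ne_zero hβ)
    (tsum_ofReal_weight hβ hZ ▸ ENNReal.ofReal_ne_top)

theorem toReal_gibbs_apply (hβ : 0 < β) (hZ : Summable fun w : State rels => weight α β w)
    (v : State rels) :
    (gibbs hβ hZ v).toReal = weight α β v / ∑' w : State rels, weight α β w := by
  rw [gibbs, PMF.normalize_apply, tsum_ofReal_weight hβ hZ, ENNReal.toReal_mul,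
    ENNReal.toReal_inv, ENNReal.toReal_ofReal (weight_pos hβ v).le,
    ENNReal.toReal_ofReal (tsum_nonneg fun w => (weight_pos hβ w).le), div_eq_mul_inv]

end Gibbs

end TrivialWords

open TrivialWords in
theorem mainTheorem1_general {A : Type*} [Fintype A] [DecidableEq A] [Nonempty A]
    (rels : Set (FreeGroup A)) (pc : ℝ) (hpc : pc ∈ Set.Ioo (0 : ℝ) 1) (α β : ℝ)
    (hβ : β ∈ Set.Ioo (0 : ℝ) 1) (P : PMF (relatorSet rels)) (hPpos : ∀ R, P R ≠ 0)
    (hPsymm : ∀ R, P R = P (relatorInv R)) :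
    (ENNReal.ofReal β < cogrowthRadius rels → Summable fun w : State rels => weight α β w) ∧
    ((Summable fun w : State rels => weight α β w) →
      ∃ π : PMF (State rels),
        (∀ v, (π v).toReal = ((v.length + 1 : ℝ) ^ (1 + α) * β ^ v.length) /
          ∑' w : State rels, weight α β w) ∧
        IsStationary (step pc hpc α β hβ P) π ∧
        (∀ φ : PMF (State rels), IsStationary (step pc hpc α β hβ P) φ → φ = π) ∧
        ∀ u v : State rels,
          Tendsto (fun n => nStep (step pc hpc α β hβ P) n u v) atTop (𝓝 (π v))) := by
  refine ⟨summable_weight_of_lt_cogrowthRadius α hβ.1, fun hZ => ?_⟩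
  have hrev : IsReversible (step pc hpc α β hβ P) (gibbs hβ.1 hZ) :=
    (step_isReversible hβ hpc hPsymm).normalize _ _
  have hirr : IsIrreducible (step pc hpc α β hβ P) := step_isIrreducible hβ hpc hPpos
  obtain ⟨e, hloop⟩ := exists_step_self_ne_zero hβ hpc (α := α) (P := P)
  exact ⟨gibbs hβ.1 hZ, toReal_gibbs_apply hβ.1 hZ, hrev.isStationary,
    fun φ => hrev.eq_of_isStationary hirr hloop, hrev.tendsto_nStep hirr hloop⟩

theorem mainTheorem1 {A : Type*} [Fintype A] [DecidableEq A] [Nonempty A]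
    (rels : Set (FreeGroup A)) (hfin : rels.Finite) (hne : (1 : FreeGroup A) ∉ rels)
    (pc : ℝ) (hpc : pc ∈ Set.Ioo (0 : ℝ) 1) (α β : ℝ) (hβ : β ∈ Set.Ioo (0 : ℝ) 1)
    (P : PMF (TrivialWords.relatorSet rels)) (hPpos : ∀ R, P R ≠ 0)
    (hPsymm : ∀ R, P R = P (TrivialWords.relatorInv R)) :
    (ENNReal.ofReal β < TrivialWords.cogrowthRadius rels →
      Summable fun w : TrivialWords.State rels => TrivialWords.weight α β w) ∧
    ((Summable fun w : TrivialWords.State rels => TrivialWords.weight α β w) →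
      ∃ π : PMF (TrivialWords.State rels),
        (∀ v, (π v).toReal = ((v.length + 1 : ℝ) ^ (1 + α) * β ^ v.length) /
          ∑' w : TrivialWords.State rels, TrivialWords.weight α β w) ∧
        TrivialWords.IsStationary (TrivialWords.step pc hpc α β hβ P) π ∧
        (∀ φ : PMF (TrivialWords.State rels),
          TrivialWords.IsStationary (TrivialWords.step pc hpc α β hβ P) φ → φ = π) ∧
        ∀ u v : TrivialWords.State rels,
          Tendsto (fun n => TrivialWords.nStep (TrivialWords.step pc hpc α β hβ P) n u v)
            atTop (𝓝 (π v))) :=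
  mainTheorem1_general rels pc hpc α β hβ P hPpos hPsymm
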